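/- Let $\varepsilon_0,\mu_0>0$ be constants. Let the magnetic permeability be the constant $\mu=\mu_0$, and let the electric permittivity $\epsilon:\mathbb R^3\to\mathbb R$ satisfy $\epsilon>0$ almost everywhere, $\epsilon\in L^\infty_{\mathrm{loc}}(\mathbb R^3)$ and $\epsilon^{-1}\in L^\infty_{\mathrm{loc}}(\mathbb R^3)$. Let the refractive index $n$ be defined by $\epsilon=\varepsilon_0 n^2$, let $\omega\in\mathbb R$, $\omega\neq 0$, and let $\kappa\in\mathbb R$ satisfy $\kappa^2=\varepsilon_0\mu_0\omega^2$. Fields are complex-valued and all equations are understood in the sense of distributions on $\mathbb R^3$. Consider the time-harmonic Maxwell system $$\nabla\times E-i\omega\mu H=0,\qquad \nabla\times H+i\omega\epsilon E=0 \tag{M}$$ and the eigenproblem $$\nabla\times\Big(\frac1{n^2}\nabla\times H\Big)=\kappa^2H,\qquad \nabla\cdot H=0. \tag{P}$$ (i) If $(E,H)\in L^2_{\mathrm{loc}}(\mathbb R^3)^3\times L^2_{\mathrm{loc}}(\mathbb R^3)^3$ is a solution of (M), then $\nabla\times H\in L^2_{\mathrm{loc}}(\mathbb R^3)^3$, $H$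 is a solution of (P), and $H\in H^1_{\mathrm{loc}}(\mathbb R^3)^3$. If moreover $(E,H)\neq(0,0)$, then $H\neq0$. (ii) Conversely, if $H$ and $\nabla\times H$ belong to $L^2_{\mathrm{loc}}(\mathbb R^3)^3$ and $H$ satisfies (P), then $H\in H^1_{\mathrm{loc}}(\mathbb R^3)^3$ and, setting $E=\frac{i}{\omega\epsilon}\nabla\times H$, one has $E\in L^2_{\mathrm{loc}}(\mathbb R^3)^3$ and $(E,H)$ is a solution of (M). -/

import Mathlib

open MeasureTheory
open scoped ENNReal

namespace MaxwellReg

/-- The Euclidean space `ℝ³`. -/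
abbrev R3 : Type := EuclideanSpace ℝ (Fin 3)

/-- Complex vector fields on `ℝ³`, as functions; all notions below are invariant under
changes on Lebesgue null sets. -/
abbrev Field3 : Type := R3 → EuclideanSpace ℂ (Fin 3)

/-- `f ∈ L^p_loc(ℝ³)`: `f` is in `L^p(K)` for every compact `K`. -/
def MemLpLoc {F : Type} [NormedAddCommGroup F] (f : R3 → F) (p : ℝ≥0∞) : Prop :=
  ∀ K : Set R3, IsCompact K → MemLp f p (volume.restrict K)

/-- `u ∈ (L²_loc(ℝ³))³`. -/
def MemL2Loc (u : Field3) : Prop :=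
  ∀ i : Fin 3, MemLpLoc (fun x => u x i) 2

/-- Test functions in `𝒟(ℝ³)`: smooth with compact support. Real-valued test functions
suffice, since the pairings below are extended to complex ones by linearity. -/
def IsTest (φ : R3 → ℝ) : Prop :=
  ContDiff ℝ ((⊤ : ℕ∞) : WithTop ℕ∞) φ ∧ HasCompactSupport φ

/-- The pairing `⟨f, φ⟩ = ∫ φ f`. -/
noncomputable def pairing (f : R3 → ℂ) (φ : R3 → ℝ) : ℂ :=
  ∫ x, φ x • f x

/-- The classical partial derivative `∂ⱼ φ`. -/
noncomputable def partialD (j : Fin 3) (φ : R3 → ℝ) : R3 → ℝ :=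
  fun x => fderiv ℝ φ x (EuclideanSpace.single j 1)

/-- The distributional partial derivative of `f`, tested against `φ`:
`⟨∂ⱼ f, φ⟩ = -⟨f, ∂ⱼ φ⟩`. -/
noncomputable def distD (j : Fin 3) (f : R3 → ℂ) (φ : R3 → ℝ) : ℂ :=
  -pairing f (partialD j φ)

/-- The components of `u` are locally integrable, hence define distributions. -/
def LocInt (u : Field3) : Prop :=
  ∀ i : Fin 3, LocallyIntegrable (fun x => u x i)

/-- `∂ⱼ f = g` in the sense of distributions. -/
def HasWeakPartial (j : Fin 3) (f g : R3 → ℂ) : Prop :=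
  LocallyIntegrable f ∧ LocallyIntegrable g ∧
    ∀ φ, IsTest φ → pairing g φ = distD j f φ

/-- `∇ × u = v` in the sense of distributions. The `i`-th component of the curl is
`∂_{i+1} u_{i+2} - ∂_{i+2} u_{i+1}`, with indices modulo `3`. -/
def HasWeakCurl (u v : Field3) : Prop :=
  LocInt u ∧ LocInt v ∧
    ∀ φ, IsTest φ → ∀ i : Fin 3,
      pairing (fun x => v x i) φ =
        distD (i + 1) (fun x => u x (i + 2)) φ - distD (i + 2) (fun x => u x (i + 1)) φ

/-- `∇ · u = g` in the sense of distributions. -/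
def HasWeakDiv (u : Field3) (g : R3 → ℂ) : Prop :=
  LocInt u ∧ LocallyIntegrable g ∧
    ∀ φ, IsTest φ → pairing g φ = ∑ i : Fin 3, distD i (fun x => u x i) φ

/-- `u ∈ (H¹_loc(ℝ³))³`: each component is in `L²_loc` and so are all its first order
weak partial derivatives. -/
def MemH1Loc (u : Field3) : Prop :=
  MemL2Loc u ∧
    ∀ i j : Fin 3, ∃ g : R3 → ℂ, MemLpLoc g 2 ∧ HasWeakPartial j (fun x => u x i) g

/-- The time-harmonic Maxwell system `∇ × E - iωμ H = 0`, `∇ × H + iωε E = 0` in the sense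
of distributions, with constant `μ`. -/
def SolvesMaxwell (ω μ : ℝ) (ε : R3 → ℝ) (E H : Field3) : Prop :=
  HasWeakCurl E (fun x => (Complex.I * ω * μ) • H x) ∧
  HasWeakCurl H (fun x => (-(Complex.I * ω * ε x)) • E x)

/-- The eigenproblem `∇ × (n⁻² ∇ × H) = κ² H`, `∇ · H = 0` in the sense of distributions,
where `C` is the weak curl of `H`. -/
def SolvesCurlCurl (κ : ℝ) (n : R3 → ℝ) (H C : Field3) : Prop :=
  HasWeakCurl H C ∧
  HasWeakCurl (fun x => ((1 / n x ^ 2 : ℝ) : ℂ) • C x) (fun x => ((κ ^ 2 : ℝ) : ℂ) • H x) ∧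
  HasWeakDiv H (fun _ => 0)

end MaxwellReg

namespace MaxwellReg

open scoped SchwartzMap LineDeriv Laplacian Real
open TemperedDistribution

/-! Algebraically the two systems are equivalent: by `hn`, dividing `∇ × H = -iωεE` by `n²` leaves
the constant multiple `-iωε₀E`, so the curl-curl equation is Faraday's law times a constant, and
`-iωε₀ · iωμ₀ = κ²`. Since `μ` is constant, `H` is a multiple of a curl, hence divergence free.

The analytic content is that `H`, `∇ × H` in `L²_loc` and `∇ · H = 0` force `H ∈ H¹_loc`
(`memH1Loc_of_curl_div`). A cutoff `χ` gives a field `χH` whose curl and divergence are in `L²`,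
because the commutator terms involve only `∇χ` and undifferentiated `H`. From `Δ = ∇ div - curl
curl` it follows that `Δ(χH) ∈ H⁻¹`, and `memSobolev_one_of_laplacian` yields `χH ∈ H¹`. Weak
derivatives found on balls agree almost everywhere on overlaps and are glued by
`exists_weak_partial_of_local`. -/

/-! ### Commuting derivatives and the vector Laplacian -/

theorem fderiv_fderiv_apply_comm {F : Type*} [NormedAddCommGroup F] [NormedSpace ℝ F]
    {f : R3 → F} (hf : ContDiff ℝ ((⊤ : ℕ∞) : WithTop ℕ∞) f) (v w x : R3) :
    fderiv ℝ (fun y => fderiv ℝ f y v) x w = fderiv ℝ (fun y => fderiv ℝ f y w) x v := by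
  have h2 : (2 : WithTop ℕ∞) ≤ ((⊤ : ℕ∞) : WithTop ℕ∞) :=
    WithTop.coe_le_coe.2 (le_top : (2 : ℕ∞) ≤ ⊤)
  have hd : DifferentiableAt ℝ (fderiv ℝ f) x :=
    ((hf.fderiv_right (m := 1) (by rwa [one_add_one_eq_two])).differentiable
      (by simp)).differentiableAt
  have hs : IsSymmSndFDerivAt ℝ f x :=
    hf.contDiffAt.isSymmSndFDerivAt (by simpa using h2)
  have key (a b : R3) : fderiv ℝ (fun y => fderiv ℝ f y a) x b = fderiv ℝ (fderiv ℝ f) x b a := by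
    rw [fderiv_clm_apply hd (differentiableAt_const a)]
    simp
  rw [key, key, hs.eq]

theorem schwartz_lineDerivOp_comm (v w : R3) (f : 𝓢(R3, ℂ)) :
    ∂_{v} (∂_{w} f) = ∂_{w} (∂_{v} f) := by
  ext x
  have h (a : R3) : (⇑(∂_{a} f : 𝓢(R3, ℂ)) : R3 → ℂ) = fun y => fderiv ℝ f y a := by
    ext y; exact SchwartzMap.lineDerivOp_apply_eq_fderiv a f y
  rw [SchwartzMap.lineDerivOp_apply_eq_fderiv, SchwartzMap.lineDerivOp_apply_eq_fderiv, h, h]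
  exact fderiv_fderiv_apply_comm (f.smooth _) _ _ _

theorem tempered_lineDerivOp_comm (v w : R3) (f : 𝓢'(R3, ℂ)) :
    ∂_{v} (∂_{w} f) = ∂_{w} (∂_{v} f) := by
  ext g
  simp only [lineDerivOp_apply_apply, LineDeriv.lineDerivOp_neg, neg_neg,
    schwartz_lineDerivOp_comm v w]

theorem tempered_lineDerivOp_sub (v : R3) (f g : 𝓢'(R3, ℂ)) :
    ∂_{v} (f - g) = ∂_{v} f - ∂_{v} g := by
  rw [sub_eq_add_neg, LineDeriv.lineDerivOp_add, LineDeriv.lineDerivOp_neg, ← sub_eq_add_neg]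

/-- The `j`-th vector of the standard basis of `ℝ³`. -/
noncomputable abbrev e (j : Fin 3) : R3 := EuclideanSpace.single j 1

theorem tempered_laplacian_eq_sum (f : 𝓢'(R3, ℂ)) : Δ f = ∑ j, ∂_{e j} (∂_{e j} f) := by
  rw [laplacian_eq_sum (EuclideanSpace.basisFun (Fin 3) ℝ)]
  simp

/-- The vector identity `Δ u = ∇ (∇ · u) - ∇ × (∇ × u)` for tempered distributions. -/
theorem tempered_laplacian_eq_of_curl_div (u c : Fin 3 → 𝓢'(R3, ℂ)) (d : 𝓢'(R3, ℂ))
    (hc : ∀ i, c i = ∂_{e (i + 1)} (u (i + 2)) - ∂_{e (i + 2)} (u (i + 1)))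
    (hd : d = ∑ i, ∂_{e i} (u i)) (i : Fin 3) :
    Δ (u i) = ∂_{e i} d - (∂_{e (i + 1)} (c (i + 2)) - ∂_{e (i + 2)} (c (i + 1))) := by
  rw [tempered_laplacian_eq_sum, hc, hc, hd]
  simp only [Fin.sum_univ_three, LineDeriv.lineDerivOp_add, tempered_lineDerivOp_sub]
  fin_cases i
  · simp only [Fin.isValue, Fin.zero_eta, Fin.reduceAdd]
    rw [tempered_lineDerivOp_comm (e 1) (e 0), tempered_lineDerivOp_comm (e 2) (e 0)]
    abel
  · simp only [Fin.isValue, Fin.mk_one, Fin.reduceAdd]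
    rw [tempered_lineDerivOp_comm (e 2) (e 1), tempered_lineDerivOp_comm (e 0) (e 1)]
    abel
  · simp only [Fin.isValue, Fin.reduceFinMk, Fin.reduceAdd]
    rw [tempered_lineDerivOp_comm (e 0) (e 2), tempered_lineDerivOp_comm (e 1) (e 2)]
    abel

/-! ### Global regularity on `ℝ³` by Bessel potentials -/

/-- Elliptic regularity for the Laplacian, from `H⁻¹` to `H¹`. -/
theorem memSobolev_one_of_laplacian {u : 𝓢'(R3, ℂ)} (hu : MemSobolev 0 2 u)
    (hΔ : MemSobolev (-1) 2 (Δ u)) : MemSobolev 1 2 u := by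
  -- On the Fourier side this is `1 = (1 + |ξ|²)⁻¹ + |ξ|² (1 + |ξ|²)⁻¹`. The factor `(2π)²` appears
  -- because `Δ` has symbol `-(2π)²|ξ|²` in this normalisation.
  have key : u = besselPotential R3 ℂ (-2) (u - (((2 * π) ^ 2)⁻¹ : ℂ) • Δ u) := by
    have h1 : besselPotential R3 ℂ (-2) (Δ u) = -((2 * π) ^ 2 : ℂ) •
        fourierMultiplierCLM ℂ
          (fun x : R3 ↦ Complex.ofReal <| ‖x‖ ^ 2 * (1 + ‖x‖ ^ 2) ^ (-1 : ℝ)) u := by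
      rw [besselPotential_neg_two_laplacian_eq]
      ext g
      simp
    have h2 : besselPotential R3 ℂ (-2) u + fourierMultiplierCLM ℂ
          (fun x : R3 ↦ Complex.ofReal <| ‖x‖ ^ 2 * (1 + ‖x‖ ^ 2) ^ (-1 : ℝ)) u = u := by
      have h3 : fourierMultiplierCLM ℂ (fun _ : R3 ↦ (1 : ℂ)) u = u := by simp
      conv_rhs => rw [← h3]
      simp only [besselPotential, fourierMultiplierCLM_apply]
      rw [← FourierTransform.fourierInv_add, ← add_apply,
        ← smulLeftCLM_add (by fun_prop) (by fun_prop)]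
      congr 3
      ext x
      simp only [Pi.add_apply]
      rw [show (-2 : ℝ) / 2 = -1 by norm_num, Real.rpow_neg_one]
      norm_cast
      field_simp
    rw [map_sub, map_smul, h1, neg_smul, smul_neg, smul_smul, inv_mul_cancel₀, one_smul,
      sub_neg_eq_add, h2]
    exact pow_ne_zero _ (by simp [Real.pi_ne_zero])
  rw [key, memSobolev_besselPotential_iff, show (-2 : ℝ) + 1 = -1 by norm_num]
  exact (hu.mono (by norm_num)).sub (hΔ.smul _)

/-- A square-integrable field with square-integrable curl and divergence is in `H¹(ℝ³)`. -/
theorem memSobolev_one_of_curl_div (u c : Fin 3 → 𝓢'(R3, ℂ)) (d : 𝓢'(R3, ℂ))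
    (hu : ∀ i, MemSobolev 0 2 (u i)) (hcL : ∀ i, MemSobolev 0 2 (c i)) (hdL : MemSobolev 0 2 d)
    (hc : ∀ i, c i = ∂_{e (i + 1)} (u (i + 2)) - ∂_{e (i + 2)} (u (i + 1)))
    (hd : d = ∑ i, ∂_{e i} (u i)) (i : Fin 3) : MemSobolev 1 2 (u i) := by
  have hD {f : 𝓢'(R3, ℂ)} (hf : MemSobolev 0 2 f) (m : R3) : MemSobolev (-1) 2 (∂_{m} f) := by
    simpa using hf.lineDerivOp (m := m)
  refine memSobolev_one_of_laplacian (hu i) ?_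
  rw [tempered_laplacian_eq_of_curl_div u c d hc hd i]
  exact (hD hdL _).sub ((hD (hcL _) _).sub (hD (hcL _) _))

/-! ### Localisation by a cutoff -/

theorem MemLpLoc.locallyIntegrable {f : R3 → ℂ} (hf : MemLpLoc f 2) : LocallyIntegrable f := by
  rw [locallyIntegrable_iff]
  intro K hK
  have : IsFiniteMeasure (volume.restrict K) := ⟨by simpa using hK.measure_lt_top⟩
  exact (hf K hK).integrable (by norm_num)

theorem memLp_smul_of_hasCompactSupport {f : R3 → ℂ} (hf : MemLpLoc f 2) {χ : R3 → ℝ}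
    (hχ : Continuous χ) (hc : HasCompactSupport χ) : MemLp (fun x => χ x • f x) 2 := by
  have h1 : MemLp (fun x => χ x • f x) 2 (volume.restrict (tsupport χ)) :=
    (hf _ hc).smul (p := ⊤) (hχ.memLp_top_of_hasCompactSupport hc _)
  rw [← memLp_indicator_iff_restrict (isClosed_tsupport χ).measurableSet] at h1
  refine h1.ae_eq (Filter.Eventually.of_forall fun x => ?_)
  by_cases hx : x ∈ tsupport χ
  · simp [hx]
  · simp [hx, image_eq_zero_of_notMem_tsupport hx]

theorem IsTest.differentiableAt {φ : R3 → ℝ} (hφ : IsTest φ) (x : R3) :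
    DifferentiableAt ℝ φ x :=
  (hφ.1.differentiable (by simp)).differentiableAt

theorem IsTest.partialD {φ : R3 → ℝ} (hφ : IsTest φ) (j : Fin 3) : IsTest (partialD j φ) := by
  refine ⟨(hφ.1.fderiv_right (m := ((⊤ : ℕ∞) : WithTop ℕ∞)) (by simp)).clm_apply contDiff_const, ?_⟩
  exact hφ.2.fderiv_apply ℝ _

theorem IsTest.mul_clm {χ : R3 → ℝ} (hχ : IsTest χ) (L : ℂ →L[ℝ] ℝ) (ψ : 𝓢(R3, ℂ)) :
    IsTest (fun x => χ x * L (ψ x)) :=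
  ⟨hχ.1.mul (L.contDiff.comp (ψ.smooth _)), hχ.2.mul_right⟩

theorem integrable_test_smul {f : R3 → ℂ} (hf : LocallyIntegrable f) {φ : R3 → ℝ}
    (hφ : IsTest φ) : Integrable (fun x => φ x • f x) :=
  hf.integrable_smul_left_of_hasCompactSupport hφ.1.continuous hφ.2

theorem partialD_mul_clm {χ : R3 → ℝ} (hχ : IsTest χ) (L : ℂ →L[ℝ] ℝ) (ψ : 𝓢(R3, ℂ))
    (j : Fin 3) (x : R3) :
    partialD j (fun x => χ x * L (ψ x)) x =
      partialD j χ x * L (ψ x) + χ x * L ((∂_{e j} ψ : 𝓢(R3, ℂ)) x) := by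
  have hψ : DifferentiableAt ℝ ψ x := ψ.differentiableAt
  have hL : HasFDerivAt (fun y => L (ψ y)) (L.comp (fderiv ℝ ψ x)) x :=
    L.hasFDerivAt.comp x hψ.hasFDerivAt
  have hm : fderiv ℝ (fun y => χ y * L (ψ y)) x =
      χ x • L.comp (fderiv ℝ ψ x) + L (ψ x) • fderiv ℝ χ x :=
    ((hχ.differentiableAt x).hasFDerivAt.mul hL).fderiv
  rw [MaxwellReg.partialD, MaxwellReg.partialD, hm, SchwartzMap.lineDerivOp_apply_eq_fderiv]
  simp [e]
  ring

/-- The tempered distribution given by a locally square-integrable function times a cutoff. -/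
noncomputable def cutoffDist {χ : R3 → ℝ} {f : R3 → ℂ} (hχ : IsTest χ) (hf : MemLpLoc f 2) :
    𝓢'(R3, ℂ) :=
  Lp.toTemperedDistribution
    ((memLp_smul_of_hasCompactSupport hf hχ.1.continuous hχ.2).toLp _)

theorem cutoffDist_memSobolev {χ : R3 → ℝ} {f : R3 → ℂ} (hχ : IsTest χ) (hf : MemLpLoc f 2) :
    MemSobolev 0 2 (cutoffDist hχ hf) :=
  memSobolev_zero_iff.2 ⟨_, rfl⟩

theorem cutoffDist_apply {χ : R3 → ℝ} {f : R3 → ℂ} (hχ : IsTest χ) (hf : MemLpLoc f 2)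
    (ψ : 𝓢(R3, ℂ)) : cutoffDist hχ hf ψ = ∫ x, ψ x * (χ x • f x) := by
  rw [cutoffDist, Lp.toTemperedDistribution_apply]
  refine integral_congr_ae ?_
  filter_upwards [(memLp_smul_of_hasCompactSupport hf hχ.1.continuous hχ.2).coeFn_toLp] with x hx
  rw [hx, smul_eq_mul]

/-- The weak equations are tested only against real functions of compact support. Splitting a
Schwartz function into real and imaginary parts, with `χ` moved onto it, makes them applicable. -/
theorem cutoffDist_apply_eq_pairing {χ : R3 → ℝ} {f : R3 → ℂ} (hχ : IsTest χ)
    (hf : MemLpLoc f 2) (ψ : 𝓢(R3, ℂ)) :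
    cutoffDist hχ hf ψ = pairing f (fun x => χ x * Complex.reCLM (ψ x)) +
      Complex.I * pairing f (fun x => χ x * Complex.imCLM (ψ x)) := by
  rw [cutoffDist_apply, pairing, pairing, ← integral_const_mul,
    ← integral_add (integrable_test_smul hf.locallyIntegrable (hχ.mul_clm _ ψ))
      ((integrable_test_smul hf.locallyIntegrable (hχ.mul_clm _ ψ)).const_mul _)]
  congr 1
  ext x
  simp only [Complex.real_smul, Complex.reCLM_apply, Complex.imCLM_apply, Complex.ofReal_mul]
  conv_lhs => rw [← Complex.re_add_im (ψ x)]
  ring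

theorem distD_mul_clm {χ : R3 → ℝ} {f : R3 → ℂ} (hχ : IsTest χ) (hf : MemLpLoc f 2)
    (L : ℂ →L[ℝ] ℝ) (ψ : 𝓢(R3, ℂ)) (j : Fin 3) :
    distD j f (fun x => χ x * L (ψ x)) =
      -pairing f (fun x => partialD j χ x * L (ψ x)) -
        pairing f (fun x => χ x * L ((∂_{e j} ψ : 𝓢(R3, ℂ)) x)) := by
  rw [distD, sub_eq_add_neg, ← neg_add, pairing, pairing, pairing,
    ← integral_add (integrable_test_smul hf.locallyIntegrable ((hχ.partialD j).mul_clm _ ψ))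
      (integrable_test_smul hf.locallyIntegrable (hχ.mul_clm _ _))]
  simp only [partialD_mul_clm hχ, add_smul]

/-- The product rule for the derivative of a cut off distribution. -/
theorem lineDerivOp_cutoffDist_apply {χ : R3 → ℝ} {f : R3 → ℂ} (hχ : IsTest χ)
    (hf : MemLpLoc f 2) (j : Fin 3) (ψ : 𝓢(R3, ℂ)) :
    (∂_{e j} (cutoffDist hχ hf) : 𝓢'(R3, ℂ)) ψ =
      distD j f (fun x => χ x * Complex.reCLM (ψ x)) +
        Complex.I * distD j f (fun x => χ x * Complex.imCLM (ψ x)) +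
        cutoffDist (hχ.partialD j) hf ψ := by
  rw [lineDerivOp_apply_apply, map_neg, cutoffDist_apply_eq_pairing,
    cutoffDist_apply_eq_pairing (hχ.partialD j), distD_mul_clm hχ hf, distD_mul_clm hχ hf]
  ring

/-- This is `χ ∇ × u + ∇χ × u = ∇ × (χu)`; no derivative of `u` survives in the commutator, so the
left side is in `L²`. -/
theorem cutoffDist_curl {χ : R3 → ℝ} (hχ : IsTest χ) {u v : Field3} (hu : MemL2Loc u)
    (hv : MemL2Loc v) (h : HasWeakCurl u v) (i : Fin 3) :
    cutoffDist hχ (hv i) + (cutoffDist (hχ.partialD (i + 1)) (hu (i + 2)) -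
        cutoffDist (hχ.partialD (i + 2)) (hu (i + 1))) =
      ∂_{e (i + 1)} (cutoffDist hχ (hu (i + 2))) - ∂_{e (i + 2)} (cutoffDist hχ (hu (i + 1))) := by
  ext ψ
  simp only [add_apply, sub_apply, lineDerivOp_cutoffDist_apply]
  rw [cutoffDist_apply_eq_pairing hχ (hv i), h.2.2 _ (hχ.mul_clm _ ψ), h.2.2 _ (hχ.mul_clm _ ψ)]
  ring

/-- The product rule leaves `∇χ · u` only, since `χ ∇ · u` vanishes. -/
theorem cutoffDist_div {χ : R3 → ℝ} (hχ : IsTest χ) {u : Field3} (hu : MemL2Loc u)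
    (h : HasWeakDiv u (fun _ => 0)) :
    ∑ i, cutoffDist (hχ.partialD i) (hu i) = ∑ i, ∂_{e i} (cutoffDist hχ (hu i)) := by
  ext ψ
  have h1 (φ : R3 → ℝ) (hφ : IsTest φ) : ∑ i : Fin 3, distD i (fun x => u x i) φ = 0 := by
    rw [← h.2.2 φ hφ]
    simp [pairing]
  have h2 := h1 _ (hχ.mul_clm Complex.reCLM ψ)
  have h3 := h1 _ (hχ.mul_clm Complex.imCLM ψ)
  simp only [Fin.sum_univ_three] at h2 h3
  simp only [Fin.sum_univ_three, add_apply, lineDerivOp_cutoffDist_apply]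
  linear_combination -h2 - Complex.I * h3

theorem cutoffDist_memSobolev_one {χ : R3 → ℝ} (hχ : IsTest χ) {u v : Field3} (hu : MemL2Loc u)
    (hv : MemL2Loc v) (hcurl : HasWeakCurl u v) (hdiv : HasWeakDiv u (fun _ => 0)) (i : Fin 3) :
    MemSobolev 1 2 (cutoffDist hχ (hu i)) := by
  refine memSobolev_one_of_curl_div (fun i => cutoffDist hχ (hu i)) _ _
    (fun i => cutoffDist_memSobolev _ _) (fun i => ?_) ?_ (cutoffDist_curl hχ hu hv hcurl)
    (cutoffDist_div hχ hu hdiv) i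
  · exact (cutoffDist_memSobolev _ _).add
      ((cutoffDist_memSobolev _ _).sub (cutoffDist_memSobolev _ _))
  · simp only [Fin.sum_univ_three]
    exact ((cutoffDist_memSobolev _ _).add (cutoffDist_memSobolev _ _)).add
      (cutoffDist_memSobolev _ _)

/-- Interior regularity: a square-integrable weak derivative on any set where the cutoff is `1`. -/
theorem exists_local_weak_partial {χ : R3 → ℝ} (hχ : IsTest χ) {u v : Field3} (hu : MemL2Loc u)
    (hv : MemL2Loc v) (hcurl : HasWeakCurl u v) (hdiv : HasWeakDiv u (fun _ => 0))
    (i j : Fin 3) :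
    ∃ g : R3 → ℂ, MemLp g 2 ∧ ∀ φ, IsTest φ → (∀ x ∈ tsupport φ, χ x = 1) →
      pairing g φ = distD j (fun x => u x i) φ := by
  have h1 : MemSobolev 0 2 (∂_{e j} (cutoffDist hχ (hu i))) := by
    simpa using (cutoffDist_memSobolev_one hχ hu hv hcurl hdiv i).lineDerivOp (m := e j)
  obtain ⟨g, hg⟩ := memSobolev_zero_iff.1 h1
  refine ⟨g, Lp.memLp g, fun φ hφ hφχ => ?_⟩
  have hc : HasCompactSupport (Complex.ofRealCLM ∘ φ) := hφ.2.comp_left rfl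
  have hd : ContDiff ℝ ((⊤ : ℕ∞) : WithTop ℕ∞) (Complex.ofRealCLM ∘ φ) :=
    Complex.ofRealCLM.contDiff.comp hφ.1
  have h2 := congrArg (fun T : 𝓢'(R3, ℂ) => T (hc.toSchwartzMap hd)) hg
  simp only [lineDerivOp_apply_apply, map_neg, cutoffDist_apply,
    Lp.toTemperedDistribution_apply] at h2
  rw [pairing, distD, pairing]
  refine Eq.trans ?_ (h2.symm.trans ?_)
  · simp
  -- The cutoff is invisible to `φ`: on `tsupport φ` it equals `1`, and elsewhere `∂ⱼ φ` vanishes.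
  · congr 1
    refine integral_congr_ae (Filter.Eventually.of_forall fun x => ?_)
    have h3 : (∂_{e j} (hc.toSchwartzMap hd) : 𝓢(R3, ℂ)) x = partialD j φ x := by
      rw [SchwartzMap.lineDerivOp_apply_eq_fderiv]
      change fderiv ℝ (Complex.ofRealCLM ∘ φ) x (e j) = _
      rw [fderiv_comp x Complex.ofRealCLM.differentiableAt (hφ.differentiableAt x)]
      simp [partialD]
    simp only [h3, Complex.real_smul]
    by_cases hx : x ∈ tsupport φ
    · simp [hφχ x hx]
    · have : partialD j φ x = 0 := by
        rw [partialD, fderiv_of_notMem_tsupport ℝ hx]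
        simp
      simp [this]

/-! ### Gluing local weak derivatives -/

theorem MemLp.memLpLoc {f : R3 → ℂ} (hf : MemLp f 2) : MemLpLoc f 2 :=
  fun _ _ => hf.restrict _

/-- A smooth cutoff that is `1` on the ball of radius `N + 1`. -/
theorem exists_cutoff (N : ℕ) :
    ∃ χ : R3 → ℝ, IsTest χ ∧ ∀ x ∈ Metric.closedBall (0 : R3) (N + 1), χ x = 1 := by
  -- The inner radius `N + 1` rather than `N` keeps it positive at `N = 0`.
  let b : ContDiffBump (0 : R3) := ⟨N + 1, N + 2, by positivity, by linarith⟩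
  exact ⟨b, ⟨b.contDiff, b.hasCompactSupport⟩, fun x hx => b.one_of_mem_closedBall hx⟩

theorem ae_eq_on_of_pairing_eq {f g : R3 → ℂ} (hf : LocallyIntegrable f)
    (hg : LocallyIntegrable g) {U : Set R3} (hU : IsOpen U)
    (h : ∀ φ, IsTest φ → tsupport φ ⊆ U → pairing f φ = pairing g φ) :
    ∀ᵐ x, x ∈ U → f x = g x := by
  have := hU.ae_eq_zero_of_integral_contDiff_smul_eq_zero (μ := volume)
    (f := fun x => f x - g x) ((hf.sub hg).locallyIntegrableOn U) (fun φ h1 h2 h3 => by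
      have hφ : IsTest φ := ⟨h1, h2⟩
      simp only [smul_sub]
      rw [integral_sub (integrable_test_smul hf hφ) (integrable_test_smul hg hφ), sub_eq_zero]
      exact h φ hφ h3)
  filter_upwards [this] with x hx hxU using sub_eq_zero.1 (hx hxU)

theorem pairing_congr_of_ae_eq_on {f g : R3 → ℂ} {φ : R3 → ℝ} {U : Set R3}
    (hφ : tsupport φ ⊆ U) (h : ∀ᵐ x, x ∈ U → f x = g x) : pairing f φ = pairing g φ := by
  refine integral_congr_ae ?_
  filter_upwards [h] with x hx
  by_cases hxφ : x ∈ tsupport φ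
  · simp only [hx (hφ hxφ)]
  · simp [image_eq_zero_of_notMem_tsupport hxφ]

/-- Weak derivatives that are given on each ball glue to one on the whole space. -/
theorem exists_weak_partial_of_local {f : R3 → ℂ} (hf : LocallyIntegrable f) (j : Fin 3)
    (h : ∀ N : ℕ, ∃ g : R3 → ℂ, MemLp g 2 ∧
      ∀ φ, IsTest φ → tsupport φ ⊆ Metric.ball 0 N → pairing g φ = distD j f φ) :
    ∃ g : R3 → ℂ, MemLpLoc g 2 ∧ HasWeakPartial j f g := by
  choose G hG hGd using h
  have hGi (N : ℕ) : LocallyIntegrable (G N) := (MemLp.memLpLoc (hG N)).locallyIntegrable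
  have hcomp (M N : ℕ) (hMN : M ≤ N) : ∀ᵐ x, x ∈ Metric.ball (0 : R3) M → G M x = G N x := by
    refine ae_eq_on_of_pairing_eq (hGi M) (hGi N) Metric.isOpen_ball fun φ hφ hs => ?_
    rw [hGd M φ hφ hs,
      hGd N φ hφ (hs.trans (Metric.ball_subset_ball (by exact_mod_cast hMN)))]
  -- `⌊‖x‖⌋₊ + 1` is the least `M` with `x` in the open ball of radius `M`, so `M ≤ N` whenever `x`
  -- lies in the ball of radius `N`.
  let g : R3 → ℂ := fun x => G (⌊‖x‖⌋₊ + 1) x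
  have hg (N : ℕ) : ∀ᵐ x, x ∈ Metric.ball (0 : R3) N → g x = G N x := by
    -- The index chosen by `g` depends on `x`, so one null set must serve all `M` at once.
    have h1 : ∀ᵐ x : R3, ∀ M : ℕ, M ≤ N → x ∈ Metric.ball (0 : R3) M → G M x = G N x := by
      refine ae_all_iff.2 fun M => ?_
      by_cases hMN : M ≤ N
      · filter_upwards [hcomp M N hMN] with x hx _ using hx
      · exact Filter.Eventually.of_forall fun x hx => absurd hx hMN
    filter_upwards [h1] with x hx hxN
    refine hx _ ?_ ?_
    · rw [mem_ball_zero_iff] at hxN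
      exact (Nat.floor_lt (norm_nonneg x)).2 hxN
    · rw [mem_ball_zero_iff]
      exact_mod_cast Nat.lt_floor_add_one ‖x‖
  have hball {K : Set R3} (hK : IsCompact K) : ∃ N : ℕ, K ⊆ Metric.ball 0 N := by
    obtain ⟨r, hr⟩ := hK.isBounded.subset_ball 0
    obtain ⟨N, hN⟩ := exists_nat_ge r
    exact ⟨N, hr.trans (Metric.ball_subset_ball hN)⟩
  have hgL : MemLpLoc g 2 := by
    intro K hK
    obtain ⟨N, hN⟩ := hball hK
    refine ((hG N).restrict K).ae_eq ?_
    refine (ae_restrict_iff' hK.measurableSet).2 ?_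
    filter_upwards [hg N] with x hx hxK using (hx (hN hxK)).symm
  refine ⟨g, hgL, hf, hgL.locallyIntegrable, fun φ hφ => ?_⟩
  obtain ⟨N, hN⟩ := hball hφ.2
  rw [pairing_congr_of_ae_eq_on hN (hg N), hGd N φ hφ hN]

/-- Locally square-integrable divergence-free fields with locally square-integrable curl are
in `H¹_loc`. -/
theorem memH1Loc_of_curl_div {u v : Field3} (hu : MemL2Loc u) (hv : MemL2Loc v)
    (hcurl : HasWeakCurl u v) (hdiv : HasWeakDiv u (fun _ => 0)) : MemH1Loc u := by
  refine ⟨hu, fun i j => exists_weak_partial_of_local (hu i).locallyIntegrable j fun N => ?_⟩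
  obtain ⟨χ, hχ, h1⟩ := exists_cutoff N
  obtain ⟨g, hg, hgd⟩ := exists_local_weak_partial hχ hu hv hcurl hdiv i j
  refine ⟨g, hg, fun φ hφ hs => hgd φ hφ fun x hx => h1 x ?_⟩
  have := mem_ball_zero_iff.1 (hs hx)
  exact mem_closedBall_zero_iff.2 (by linarith)

/-! ### Calculus of weak curl and divergence -/

theorem partialD_comm {φ : R3 → ℝ} (hφ : IsTest φ) (i j : Fin 3) :
    partialD i (partialD j φ) = partialD j (partialD i φ) := by
  funext x
  exact fderiv_fderiv_apply_comm hφ.1 _ _ _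

theorem pairing_const_mul (a : ℂ) (f : R3 → ℂ) (φ : R3 → ℝ) :
    pairing (fun x => a * f x) φ = a * pairing f φ := by
  rw [pairing, pairing, ← integral_const_mul]
  simp only [Complex.real_smul]
  congr 1
  ext x
  ring

theorem distD_const_mul (a : ℂ) (j : Fin 3) (f : R3 → ℂ) (φ : R3 → ℝ) :
    distD j (fun x => a * f x) φ = a * distD j f φ := by
  rw [distD, distD, pairing_const_mul]
  ring

theorem pairing_congr_ae {f g : R3 → ℂ} (h : f =ᵐ[volume] g) (φ : R3 → ℝ) :
    pairing f φ = pairing g φ :=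
  integral_congr_ae (h.mono fun x hx => by simp only [hx])

theorem component_congr_ae {u v : Field3} (h : u =ᵐ[volume] v) (i : Fin 3) :
    (fun x => u x i) =ᵐ[volume] fun x => v x i :=
  h.mono fun x hx => by simp only [hx]

theorem LocInt.congr_ae {u v : Field3} (hu : LocInt u) (h : u =ᵐ[volume] v) : LocInt v :=
  fun i => (locallyIntegrable_congr (component_congr_ae h i)).1 (hu i)

theorem HasWeakCurl.congr_ae {u v u' v' : Field3} (h : HasWeakCurl u v)
    (hu : u =ᵐ[volume] u') (hv : v =ᵐ[volume] v') : HasWeakCurl u' v' := by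
  refine ⟨h.1.congr_ae hu, h.2.1.congr_ae hv, fun φ hφ i => ?_⟩
  have := h.2.2 φ hφ i
  simp only [distD] at this ⊢
  rwa [← pairing_congr_ae (component_congr_ae hv i),
    ← pairing_congr_ae (component_congr_ae hu (i + 1)),
    ← pairing_congr_ae (component_congr_ae hu (i + 2))]

theorem LocInt.const_smul {u : Field3} (hu : LocInt u) (a : ℂ) : LocInt (fun x => a • u x) :=
  fun i => (hu i).smul a

theorem HasWeakCurl.const_smul {u v : Field3} (h : HasWeakCurl u v) (a : ℂ) :
    HasWeakCurl (fun x => a • u x) (fun x => a • v x) := by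
  refine ⟨h.1.const_smul a, h.2.1.const_smul a, fun φ hφ i => ?_⟩
  simp only [PiLp.smul_apply, smul_eq_mul, pairing_const_mul, distD_const_mul]
  rw [h.2.2 φ hφ i]
  ring

/-- A curl is divergence free. -/
theorem HasWeakCurl.hasWeakDiv {u v : Field3} (h : HasWeakCurl u v) :
    HasWeakDiv v (fun _ => 0) := by
  refine ⟨h.2.1, locallyIntegrable_zero, fun φ hφ => ?_⟩
  -- Both derivatives are moved onto `φ`, where the mixed partials cancel in pairs.
  have key (i : Fin 3) : distD i (fun x => v x i) φ =
      pairing (fun x => u x (i + 2)) (partialD (i + 1) (partialD i φ)) -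
        pairing (fun x => u x (i + 1)) (partialD (i + 2) (partialD i φ)) := by
    rw [distD, h.2.2 _ (hφ.partialD i), distD, distD]
    ring
  simp only [key, Fin.sum_univ_three, Fin.isValue, Fin.reduceAdd]
  rw [partialD_comm hφ 1 0, partialD_comm hφ 2 1, partialD_comm hφ 2 0]
  simp [pairing]

theorem HasWeakDiv.const_smul_zero {u : Field3} (h : HasWeakDiv u (fun _ => 0)) (a : ℂ) :
    HasWeakDiv (fun x => a • u x) (fun _ => 0) := by
  refine ⟨h.1.const_smul a, h.2.1, fun φ hφ => ?_⟩
  have := h.2.2 φ hφ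
  simp only [PiLp.smul_apply, smul_eq_mul, distD_const_mul, ← Finset.mul_sum]
  rw [← this]
  simp [pairing]

theorem MemL2Loc.congr_ae {u v : Field3} (hu : MemL2Loc u) (h : u =ᵐ[volume] v) : MemL2Loc v :=
  fun i K hK => (hu i K hK).ae_eq (ae_restrict_of_ae (component_congr_ae h i))

theorem MemL2Loc.const_smul {u : Field3} (hu : MemL2Loc u) (a : ℂ) :
    MemL2Loc (fun x => a • u x) :=
  fun i K hK => (hu i K hK).const_smul a

theorem MemL2Loc.smul_of_top {u : Field3} (hu : MemL2Loc u) {a : R3 → ℝ} (ha : MemLpLoc a ⊤) :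
    MemL2Loc (fun x => (a x : ℂ) • u x) := by
  intro i K hK
  have h : MemLp (fun x => a x • u x i) 2 (volume.restrict K) := (hu i K hK).smul (ha K hK)
  simpa using h

/-- Used for nontriviality: `H = 0` forces `εE = 0`. -/
theorem HasWeakCurl.ae_eq_zero {u v : Field3} (h : HasWeakCurl u v) (hu : u =ᵐ[volume] 0) :
    v =ᵐ[volume] 0 := by
  have key (i : Fin 3) : ∀ᵐ x, v x i = 0 := by
    refine ae_eq_zero_of_integral_contDiff_smul_eq_zero (h.2.1 i) fun φ h1 h2 => ?_
    have h3 := h.2.2 φ ⟨h1, h2⟩ i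
    simp only [distD] at h3
    rw [pairing_congr_ae (component_congr_ae hu (i + 1)),
      pairing_congr_ae (component_congr_ae hu (i + 2))] at h3
    simpa [pairing] using h3
  filter_upwards [ae_all_iff.2 key] with x hx
  ext i
  exact hx i

/-! ### The two implications -/

theorem maxwell_imp_curlCurl
    (ε₀ μ₀ : ℝ) (hε₀ : 0 < ε₀) (hμ₀ : 0 < μ₀)
    (ε n : R3 → ℝ) (hεpos : ∀ᵐ x, 0 < ε x)
    (hε : MemLpLoc ε ⊤) (hn : ∀ᵐ x, ε x = ε₀ * n x ^ 2)
    (ω κ : ℝ) (hω : ω ≠ 0) (hκ : κ ^ 2 = ε₀ * μ₀ * ω ^ 2) (E H : Field3)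
    (hE : MemL2Loc E) (hH : MemL2Loc H) (h : SolvesMaxwell ω μ₀ ε E H) :
    (∃ C : Field3, MemL2Loc C ∧ SolvesCurlCurl κ n H C) ∧ MemH1Loc H ∧
      (¬ (E =ᵐ[volume] 0 ∧ H =ᵐ[volume] 0) → ¬ H =ᵐ[volume] 0) := by
  have hωC : (ω : ℂ) ≠ 0 := by exact_mod_cast hω
  have hμC : (μ₀ : ℂ) ≠ 0 := by exact_mod_cast hμ₀.ne'
  have hεC : (ε₀ : ℂ) ≠ 0 := by exact_mod_cast hε₀.ne'
  have hC : MemL2Loc (fun x => (-(Complex.I * ω * ε x)) • E x) := by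
    refine ((hE.smul_of_top hε).const_smul (-(Complex.I * ω))).congr_ae
      (Filter.Eventually.of_forall fun x => ?_)
    simp only [smul_smul]
    ring_nf
  have hdiv : HasWeakDiv H (fun _ => 0) := by
    have h1 := h.1.hasWeakDiv.const_smul_zero (Complex.I * ω * μ₀)⁻¹
    have hne : Complex.I * ω * μ₀ ≠ 0 := mul_ne_zero (mul_ne_zero Complex.I_ne_zero hωC) hμC
    simpa only [smul_smul, inv_mul_cancel₀ hne, one_smul] using h1
  refine ⟨⟨_, hC, h.2, ?_, hdiv⟩, memH1Loc_of_curl_div hH hC h.2 hdiv, fun h0 hH0 => h0 ⟨?_, hH0⟩⟩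
  -- Faraday's law times `-iωε₀`. Cancelling `n²` needs `n ≠ 0` almost everywhere, which follows
  -- from `ε > 0`.
  · refine (h.1.const_smul (-(Complex.I * ω * ε₀))).congr_ae ?_
      (Filter.Eventually.of_forall fun x => ?_)
    · filter_upwards [hεpos, hn] with x hx hnx
      have hn0 : (n x : ℂ) ≠ 0 := by
        intro h0
        have : n x = 0 := by exact_mod_cast h0
        rw [hnx, this] at hx
        simp at hx
      rw [smul_smul, hnx]
      congr 1
      push_cast
      field_simp
    · simp only [smul_smul]
      congr 1
      rw [hκ]
      push_cast
      linear_combination (-ω ^ 2 * ε₀ * μ₀ : ℂ) * Complex.I_sq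
  · filter_upwards [h.2.ae_eq_zero hH0, hεpos] with x hx hpos
    have hne : (-(Complex.I * ω * ε x) : ℂ) ≠ 0 := by
      simp [hωC, hpos.ne']
    exact (smul_eq_zero.1 hx).resolve_left hne

theorem curlCurl_imp_maxwell
    (ε₀ μ₀ : ℝ) (hε₀ : 0 < ε₀) (ε n : R3 → ℝ) (hεpos : ∀ᵐ x, 0 < ε x)
    (hεinv : MemLpLoc (fun x => (ε x)⁻¹) ⊤) (hn : ∀ᵐ x, ε x = ε₀ * n x ^ 2)
    (ω κ : ℝ) (hω : ω ≠ 0) (hκ : κ ^ 2 = ε₀ * μ₀ * ω ^ 2) (H C : Field3)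
    (hH : MemL2Loc H) (hC : MemL2Loc C) (h : SolvesCurlCurl κ n H C) :
    MemH1Loc H ∧ MemL2Loc (fun x => (Complex.I / (ω * ε x)) • C x) ∧
      SolvesMaxwell ω μ₀ ε (fun x => (Complex.I / (ω * ε x)) • C x) H := by
  have hωC : (ω : ℂ) ≠ 0 := by exact_mod_cast hω
  have hεC : (ε₀ : ℂ) ≠ 0 := by exact_mod_cast hε₀.ne'
  refine ⟨memH1Loc_of_curl_div hH hC h.1 h.2.2, ?_, ?_, ?_⟩
  · refine ((hC.smul_of_top hεinv).const_smul (Complex.I / ω)).congr_ae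
      (Filter.Eventually.of_forall fun x => ?_)
    simp only [smul_smul]
    congr 1
    push_cast
    rw [div_mul_eq_div_div, div_eq_mul_inv _ (ε x : ℂ)]
  -- The factor is forced by `i/(ωε) = (i/(ωε₀)) n⁻²`; the right side becomes `(i/(ωε₀)) κ² H = iωμ₀
  -- H`.
  · refine (h.2.1.const_smul (Complex.I / (ω * ε₀))).congr_ae ?_
      (Filter.Eventually.of_forall fun x => ?_)
    · filter_upwards [hn] with x hnx
      rw [smul_smul, hnx]
      congr 1
      push_cast
      rw [div_mul_div_comm, mul_one, mul_assoc]
    · simp only [smul_smul]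
      congr 1
      rw [hκ]
      push_cast
      field_simp
  · refine h.1.congr_ae Filter.EventuallyEq.rfl ?_
    filter_upwards [hεpos] with x hx
    have hx' : (ε x : ℂ) ≠ 0 := by exact_mod_cast hx.ne'
    rw [smul_smul]
    have : -(Complex.I * ω * ε x) * (Complex.I / (ω * ε x)) = (1 : ℂ) := by
      field_simp
      simp
    rw [this, one_smul]

end MaxwellReg

theorem mainTheorem7
    (ε₀ μ₀ : ℝ) (hε₀ : 0 < ε₀) (hμ₀ : 0 < μ₀)
    (ε n : MaxwellReg.R3 → ℝ)
    (hεpos : ∀ᵐ x, 0 < ε x)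
    (hε : MaxwellReg.MemLpLoc ε ⊤)
    (hεinv : MaxwellReg.MemLpLoc (fun x => (ε x)⁻¹) ⊤)
    (hn : ∀ᵐ x, ε x = ε₀ * n x ^ 2)
    (ω κ : ℝ) (hω : ω ≠ 0) (hκ : κ ^ 2 = ε₀ * μ₀ * ω ^ 2) :
    (∀ E H : MaxwellReg.Field3,
      MaxwellReg.MemL2Loc E → MaxwellReg.MemL2Loc H →
      MaxwellReg.SolvesMaxwell ω μ₀ ε E H →
        (∃ C : MaxwellReg.Field3,
          MaxwellReg.MemL2Loc C ∧ MaxwellReg.SolvesCurlCurl κ n H C) ∧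
        MaxwellReg.MemH1Loc H ∧
        (¬ (E =ᵐ[volume] 0 ∧ H =ᵐ[volume] 0) → ¬ H =ᵐ[volume] 0)) ∧
    (∀ H C : MaxwellReg.Field3,
      MaxwellReg.MemL2Loc H → MaxwellReg.MemL2Loc C →
      MaxwellReg.SolvesCurlCurl κ n H C →
        MaxwellReg.MemH1Loc H ∧
        MaxwellReg.MemL2Loc (fun x => (Complex.I / (ω * ε x)) • C x) ∧
        MaxwellReg.SolvesMaxwell ω μ₀ ε (fun x => (Complex.I / (ω * ε x)) • C x) H) := by
  exact ⟨fun E H hE hH h => MaxwellReg.maxwell_imp_curlCurl ε₀ μ₀ hε₀ hμ₀ ε n hεpos hε hn ω κ hω hκ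
      E H hE hH h,
    fun H C hH hC h => MaxwellReg.curlCurl_imp_maxwell ε₀ μ₀ hε₀ ε n hεpos hεinv hn ω κ hω hκ
      H C hH hC h⟩
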